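/- Let $x\in(0,1)$ be irrational, let $P_k/Q_k$ ($k\ge 0$, $Q_0=1$) be the convergents of its regular continued fraction, and let $t\in\mathbb R$. For $s>0$ and $n\ge 1$ put $$S_n=\sum_{k=1}^n e^{i\pi k^2x+2i\pi kt},\qquad F_{s,n}(x,t)=\sum_{k=1}^n\frac{e^{i\pi k^2x+2i\pi kt}}{k^s}.$$ Abel summation gives $F_{s,n}(x,t)=\sum_{k=1}^{n-1}\bigl(\frac1{k^s}-\frac1{(k+1)^s}\bigr)S_k+\frac{S_n}{n^s}$. Say that $F_s(x,t)=\sum_{k\ge1}e^{i\pi k^2x+2i\pi kt}/k^s$ is absolutely convergent after Abel summation if $$\sum_{k=1}^\infty\Bigl|\Bigl(\frac1{k^s}-\frac1{(k+1)^s}\Bigr)S_k\Bigr|<\infty,\qquad \lim_{n\to\infty}\frac{S_n}{n^s}=0,\qquad \lim_{n\to\infty}F_{s,n}(x,t)=\sum_{k=1}^\infty\Bigl(\frac1{k^s}-\frac1{(k+1)^s}\Bigr)S_k .$$ (i) If $s\in(\frac12,1)$ and $\sum_{k=0}^\infty Q_{k+1}^{(1-s)/2}/Q_k^{s/2}<\infty$,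 then $F_s(x,t)$ is absolutely convergent after Abel summation; in particular the series $F_s(x,t)$ converges. (ii) If $\sum_{k=0}^\infty \log(Q_{k+1})/\sqrt{Q_k}<\infty$, then $F_1(x,t)$ is absolutely convergent after Abel summation; in particular the series $F_1(x,t)$ converges. -/

import Mathlib

open Filter Topology

noncomputable section

/-- The exponential sum `∑_{k=1}^n e^{iπ k² x + 2iπ k t}`. -/
def thetaSum (x t : ℝ) (n : ℕ) : ℂ :=
  ∑ k ∈ Finset.Icc 1 n,
    Complex.exp (Complex.I * Real.pi * (k : ℂ) ^ 2 * x + 2 * Complex.I * Real.pi * k * t)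

/-- The partial sum `F_{s,n}(x,t) = ∑_{k=1}^n e^{iπ k² x + 2iπ k t} / k^s`. -/
def partialF (s x t : ℝ) (n : ℕ) : ℂ :=
  ∑ k ∈ Finset.Icc 1 n,
    Complex.exp (Complex.I * Real.pi * (k : ℂ) ^ 2 * x + 2 * Complex.I * Real.pi * k * t) /
      (((k : ℝ) ^ s : ℝ) : ℂ)

/-- The `k`-th summand (`k ≥ 1`) of the series obtained from `F_s(x,t)` by Abel summation,
`(1/k^s - 1/(k+1)^s) ∑_{j=1}^k e^{iπ j² x + 2iπ j t}`. -/
def abelTerm (s x t : ℝ) (k : ℕ) : ℂ :=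
  ((1 / (k : ℝ) ^ s - 1 / ((k : ℝ) + 1) ^ s : ℝ) : ℂ) * thetaSum x t k

/-- The last summand `N^{-s} ∑_{k=1}^N e^{iπ k² x + 2iπ k t}` in the Abel summation of
`F_{s,N}(x,t)`. -/
def abelBoundary (s x t : ℝ) (N : ℕ) : ℂ :=
  ((1 / (N : ℝ) ^ s : ℝ) : ℂ) * thetaSum x t N

/-- `F_s(x,t)` converges absolutely after Abel summation: the Abel-summed series
`∑_{k ≥ 1} (1/k^s - 1/(k+1)^s) ∑_{j ≤ k} e^{iπ j² x + 2iπ j t}` is absolutely convergent, the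
boundary term tends to `0`, and the partial sums `F_{s,n}(x,t)` converge to the sum of that
series. -/
def AbelAbsolutelyConvergent (s x t : ℝ) : Prop :=
  Summable (fun k : ℕ => ‖abelTerm s x t (k + 1)‖) ∧
  Tendsto (abelBoundary s x t) atTop (𝓝 0) ∧
  Tendsto (partialF s x t) atTop (𝓝 (∑' k : ℕ, abelTerm s x t (k + 1)))

/-- The denominator `Q_k` of the `k`-th convergent `P_k/Q_k` of the regular continued fraction
of `x` (`Q_0 = 1`). -/
def convDen (x : ℝ) (k : ℕ) : ℝ := (GenContFract.of x).dens k

end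

theorem not_terminatedAt_of_irrational {x : ℝ} (hx : Irrational x) (n : ℕ) :
    ¬ (GenContFract.of x).TerminatedAt n := by
  intro h
  obtain ⟨q, hq⟩ := (GenContFract.terminates_iff_rat x).1 ⟨n, h⟩
  exact hx ⟨q, hq.symm⟩

theorem exists_int_contsAux (x : ℝ) (n : ℕ) :
    (∃ a b : ℤ, ((GenContFract.of x).contsAux n).a = a ∧ ((GenContFract.of x).contsAux n).b = b) ∧
    ∃ a b : ℤ, ((GenContFract.of x).contsAux (n + 1)).a = a ∧
      ((GenContFract.of x).contsAux (n + 1)).b = b := by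
  induction n with
  | zero =>
    refine ⟨⟨1, 0, by simp [GenContFract.contsAux]⟩, ⟨⌊x⌋, 1, ?_⟩⟩
    simp [GenContFract.contsAux, GenContFract.of_h_eq_floor]
  | succ n ih =>
    refine ⟨ih.2, ?_⟩
    obtain ⟨⟨a, b, ha, hb⟩, c, d, hc, hd⟩ := ih
    by_cases hT : (GenContFract.of x).TerminatedAt n
    · rw [GenContFract.contsAux_stable_step_of_terminated hT]
      exact ⟨c, d, hc, hd⟩
    · obtain ⟨gp, hgp⟩ := Option.ne_none_iff_exists'.1 hT
      obtain ⟨h1, z, hz⟩ := GenContFract.of_partNum_eq_one_and_exists_int_partDen_eq hgp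
      refine ⟨z * c + a, z * d + b, ?_⟩
      rw [GenContFract.contsAux_recurrence hgp rfl rfl]
      simp [h1, hz, ha, hb, hc, hd]

theorem fib_le_convDen {x : ℝ} (hx : Irrational x) (k : ℕ) : (Nat.fib (k + 1) : ℝ) ≤ convDen x k :=
  GenContFract.succ_nth_fib_le_of_nth_den (Or.inr (not_terminatedAt_of_irrational hx _))

theorem one_le_convDen {x : ℝ} (hx : Irrational x) (k : ℕ) : 1 ≤ convDen x k :=
  le_trans (by exact_mod_cast Nat.fib_pos.2 k.succ_pos) (fib_le_convDen hx k)

theorem exists_coprime_convDen {x : ℝ} (hx : Irrational x) (k : ℕ) :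
    ∃ (p : ℤ) (q : ℕ), (q : ℝ) = convDen x k ∧ IsCoprime p (q : ℤ) ∧
      |(q : ℝ) * x - p| ≤ 1 / q := by
  have hT := not_terminatedAt_of_irrational hx k
  obtain ⟨⟨a, b, ha, hb⟩, a', b', ha', hb'⟩ := exists_int_contsAux x (k + 1)
  have hdet := (SimpContFract.of x).determinant hT
  change ((GenContFract.of x).contsAux (k + 1)).a * ((GenContFract.of x).contsAux (k + 2)).b -
    ((GenContFract.of x).contsAux (k + 1)).b * ((GenContFract.of x).contsAux (k + 2)).a = _ at hdet
  rw [ha, hb, ha', hb'] at hdet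
  have hdet' : a * b' - b * a' = (-1) ^ (k + 1) := by exact_mod_cast hdet
  have hden : (b : ℝ) = convDen x k := hb.symm
  have hden' : (b' : ℝ) = convDen x (k + 1) := hb'.symm
  have h1 := one_le_convDen hx k
  have hb1 : 1 ≤ b := by rw [← hden] at h1; exact_mod_cast h1
  have hmono : convDen x k ≤ convDen x (k + 1) := GenContFract.of_den_mono
  have happ := GenContFract.abs_sub_convs_le hT
  obtain ⟨q, rfl⟩ := Int.eq_ofNat_of_zero_le (by omega : 0 ≤ b)
  have hcop : IsCoprime a (q : ℤ) := by
    rcases neg_one_pow_eq_or ℤ (k + 1) with h | h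
    · exact ⟨b', -a', by rw [h] at hdet'; linarith⟩
    · exact ⟨-b', a', by rw [h] at hdet'; linarith⟩
  refine ⟨a, q, by exact_mod_cast hden, hcop, ?_⟩
  have hc : (GenContFract.of x).convs k = a / q := by
    rw [GenContFract.conv_eq_conts_a_div_conts_b]
    change ((GenContFract.of x).contsAux (k + 1)).a / ((GenContFract.of x).contsAux (k + 1)).b = _
    rw [ha, hb]; simp
  have hq : (q : ℝ) = convDen x k := by exact_mod_cast hden
  change _ ≤ 1 / (convDen x k * convDen x (k + 1)) at happ
  rw [hc] at happ
  have hq0 : (0 : ℝ) < q := by linarith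
  have : (q : ℝ) * x - a = q * (x - a / q) := by field_simp
  rw [this, abs_mul, abs_of_pos hq0]
  calc (q : ℝ) * |x - a / q| ≤ q * (1 / (q * q)) := by
        gcongr
        refine happ.trans ?_
        rw [← hq] at hmono ⊢
        gcongr
    _ = 1 / q := by field_simp

theorem convDen_mono (x : ℝ) : Monotone (convDen x) :=
  monotone_nat_of_le_succ fun _ => GenContFract.of_den_mono

/-- If `p / q` is a reduced fraction with `|q x - p| ≤ 1 / q`, then the nonzero multiples `h x`
with `|h| ≤ q / 2` are at distance at least `1 / (2 q)` from the integers. -/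
theorem inv_le_abs_mul_sub_int {x : ℝ} {p : ℤ} {q : ℕ} (hq : 0 < q) (hpq : IsCoprime p (q : ℤ))
    (hx : |(q : ℝ) * x - p| ≤ 1 / q) {h : ℤ} (h0 : h ≠ 0) (hh : 2 * |h| ≤ q) (m : ℤ) :
    1 / (2 * q) ≤ |(h : ℝ) * x - m| := by
  have hq0 : (0 : ℝ) < q := by exact_mod_cast hq
  have hne : h * p - m * q ≠ 0 := by
    intro he
    have hd : (q : ℤ) ∣ h := hpq.symm.dvd_of_dvd_mul_right ⟨m, by linarith⟩
    have := Int.le_of_dvd (abs_pos.2 h0) ((dvd_abs _ _).2 hd)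
    have := abs_pos.2 h0
    omega
  have h1 : (1 : ℝ) ≤ |(h * p - m * q : ℝ)| := by
    have := Int.one_le_abs hne
    exact_mod_cast this
  have h2 : |(h : ℝ) * (q * x - p)| ≤ 1 / 2 := by
    rw [abs_mul]
    have hh' : 2 * |(h : ℝ)| ≤ q := by exact_mod_cast hh
    calc |(h : ℝ)| * |(q : ℝ) * x - p| ≤ (q / 2) * (1 / q) := by
          gcongr; linarith
      _ = 1 / 2 := by field_simp
  have h3 : (q : ℝ) * |(h : ℝ) * x - m| = |(h * p - m * q : ℝ) + h * (q * x - p)| := by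
    rw [← abs_of_pos hq0, ← abs_mul, abs_of_pos hq0]; congr 1; ring
  have h4 : (1 : ℝ) / 2 ≤ q * |(h : ℝ) * x - m| := by
    rw [h3]
    have := abs_sub_abs_le_abs_sub (h * p - m * q : ℝ) (-(h * (q * x - p)))
    rw [sub_neg_eq_add, abs_neg] at this
    linarith
  rw [div_le_iff₀ (by positivity)]
  linarith

/-- The distance from `h x` to the nearest integer. -/
noncomputable def distInt (x : ℝ) (h : ℕ) : ℝ := |(h : ℝ) * x - round ((h : ℝ) * x)|

theorem card_distInt_lt_Ico {x : ℝ} {p : ℤ} {q : ℕ} (hq : 0 < q) (hpq : IsCoprime p (q : ℤ))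
    (hx : |(q : ℝ) * x - p| ≤ 1 / q) {r : ℝ} (hr : 0 ≤ r) (a L : ℕ) (hL : 2 * L ≤ q + 2) :
    (((Finset.Ico a (a + L)).filter (fun h => distInt x h < r)).card : ℝ) ≤ 4 * q * r + 2 := by
  have hq0 : (0 : ℝ) < q := by exact_mod_cast hq
  set y : ℕ → ℝ := fun h => (h : ℝ) * x - round ((h : ℝ) * x) with hy
  set R : ℝ := 2 * q * r with hR
  have hR0 : 0 ≤ R := by positivity
  have hmaps : ∀ h ∈ (Finset.Ico a (a + L)).filter (fun h => distInt x h < r),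
      ⌊2 * q * y h⌋ ∈ Finset.Icc (⌊-R⌋) ⌊R⌋ := by
    intro h hh
    have h1 : |y h| < r := (Finset.mem_filter.1 hh).2
    rw [abs_lt] at h1
    refine Finset.mem_Icc.2 ⟨Int.floor_le_floor ?_, Int.floor_le_floor ?_⟩
    · rw [hR]; nlinarith
    · rw [hR]; nlinarith
  have hinj : Set.InjOn (fun h => ⌊2 * q * y h⌋)
      ((Finset.Ico a (a + L)).filter (fun h => distInt x h < r) : Set ℕ) := by
    intro h hh h' hh' he
    simp only [Finset.coe_filter, Set.mem_ofPred_eq, Finset.mem_Ico] at hh hh'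
    by_contra hne
    have hsep := inv_le_abs_mul_sub_int hq hpq hx (h := (h : ℤ) - h') (by omega)
      (by rcases abs_cases ((h : ℤ) - h') with h | h <;> omega)
      (round ((h : ℝ) * x) - round ((h' : ℝ) * x))
    have h1 : |2 * q * y h - 2 * q * y h'| < 1 := Int.abs_sub_lt_one_of_floor_eq_floor he
    have h2 : ((((h : ℤ) - h' : ℤ) : ℝ) * x - ((round ((h : ℝ) * x) - round ((h' : ℝ) * x) : ℤ) : ℝ))
        = y h - y h' := by
      simp only [hy]; push_cast; ring
    rw [h2, div_le_iff₀ (by positivity)] at hsep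
    rw [← mul_sub, abs_mul, abs_of_pos (by positivity : (0 : ℝ) < 2 * q)] at h1
    linarith
  have hcard := Finset.card_le_card_of_injOn _ hmaps hinj
  rw [Int.card_Icc] at hcard
  have hle : ⌊-R⌋ ≤ ⌊R⌋ := Int.floor_le_floor (by linarith)
  have h3 : ((⌊R⌋ + 1 - ⌊-R⌋).toNat : ℝ) = (⌊R⌋ : ℝ) + 1 - ⌊-R⌋ := by
    have : ((⌊R⌋ + 1 - ⌊-R⌋).toNat : ℤ) = ⌊R⌋ + 1 - ⌊-R⌋ := Int.toNat_of_nonneg (by omega)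
    exact_mod_cast this
  have h4 := Int.floor_le R
  have h5 := Int.sub_one_lt_floor (-R)
  calc _ ≤ ((⌊R⌋ + 1 - ⌊-R⌋).toNat : ℝ) := by exact_mod_cast hcard
    _ ≤ 4 * q * r + 2 := by rw [h3]; linarith

theorem card_distInt_lt {x : ℝ} {p : ℤ} {q : ℕ} (hq : 0 < q) (hpq : IsCoprime p (q : ℤ))
    (hx : |(q : ℝ) * x - p| ≤ 1 / q) {r : ℝ} (hr : 0 ≤ r) (N : ℕ) :
    (((Finset.range N).filter (fun h => distInt x h < r)).card : ℝ) ≤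
      (2 * N / q + 1) * (4 * q * r + 2) := by
  have hq0 : (0 : ℝ) < q := by exact_mod_cast hq
  set L := q / 2 + 1 with hL
  have hblocks : ∀ M : ℕ, (((Finset.range (M * L)).filter (fun h => distInt x h < r)).card : ℝ) ≤
      M * (4 * q * r + 2) := by
    intro M
    induction M with
    | zero => simp
    | succ M ih =>
      have hsplit : Finset.range ((M + 1) * L) =
          Finset.range (M * L) ∪ Finset.Ico (M * L) (M * L + L) := by
        ext h
        simp only [Finset.mem_union, Finset.mem_range, Finset.mem_Ico, add_mul, one_mul]
        omega
      rw [hsplit, Finset.filter_union]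
      have h1 := card_distInt_lt_Ico hq hpq hx hr (M * L) L (by omega)
      have h2 := (Nat.cast_le (α := ℝ)).2 (Finset.card_union_le
        ((Finset.range (M * L)).filter (fun h => distInt x h < r))
        ((Finset.Ico (M * L) (M * L + L)).filter (fun h => distInt x h < r)))
      push_cast at h2 ⊢
      linarith
  have hsub : (Finset.range N).filter (fun h => distInt x h < r) ⊆
      (Finset.range ((N / L + 1) * L)).filter (fun h => distInt x h < r) := by
    apply Finset.filter_subset_filter
    rw [Finset.range_subset_range]
    exact (Nat.lt_mul_of_div_lt (Nat.lt_succ_self _) (by omega)).le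
  refine (Nat.cast_le.2 (Finset.card_le_card hsub)).trans ((hblocks _).trans ?_)
  gcongr
  push_cast
  gcongr
  have hL2 : (q : ℝ) / 2 ≤ L := by
    have : q ≤ 2 * L := by omega
    have : (q : ℝ) ≤ 2 * L := by exact_mod_cast this
    linarith
  calc ((N / L : ℕ) : ℝ) ≤ (N : ℝ) / L := Nat.cast_div_le
    _ ≤ N / (q / 2) := by gcongr
    _ = 2 * N / q := by field_simp

theorem sum_range_mul_conj_eq {R : Type*} [AddCommMonoid R] (g : ℕ → ℕ → R) (N : ℕ) :
    ∑ h ∈ Finset.Ico 1 (N + 1), ∑ k ∈ Finset.range (N + 1 - h), g (k + h) k =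
      ∑ h ∈ Finset.Ico 1 N, ∑ k ∈ Finset.range (N - h), g (k + h) k +
        ∑ k ∈ Finset.range N, g N k := by
  have h1 : ∑ h ∈ Finset.Ico 1 (N + 1), ∑ k ∈ Finset.range (N - h), g (k + h) k =
      ∑ h ∈ Finset.Ico 1 N, ∑ k ∈ Finset.range (N - h), g (k + h) k := by
    rcases Nat.eq_zero_or_pos N with rfl | hN
    · simp
    · rw [Finset.sum_Ico_succ_top hN]; simp
  have h2 : ∑ h ∈ Finset.Ico 1 (N + 1), g N (N - h) = ∑ k ∈ Finset.range N, g N k := by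
    rw [Finset.sum_Ico_eq_sum_range, ← Finset.sum_range_reflect (fun k => g N k) N]
    refine Finset.sum_congr (by simp) fun k hk => ?_
    congr 1; omega
  rw [← h1, ← h2, ← Finset.sum_add_distrib]
  refine Finset.sum_congr rfl fun h hh => ?_
  rw [Finset.mem_Ico] at hh
  rw [show N + 1 - h = N - h + 1 by omega, Finset.sum_range_succ,
    show N - h + h = N by omega]

/-- Weyl's differencing inequality for sums of unimodular complex numbers. -/
theorem norm_sum_range_sq_le (c : ℕ → ℂ) (hc : ∀ k, ‖c k‖ = 1) (N : ℕ) :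
    ‖∑ k ∈ Finset.range N, c k‖ ^ 2 ≤
      N + 2 * ∑ h ∈ Finset.range N,
        ‖∑ k ∈ Finset.range (N - h), c (k + h) * (starRingEnd ℂ) (c k)‖ := by
  have hid : ‖∑ k ∈ Finset.range N, c k‖ ^ 2 = N + 2 * (∑ h ∈ Finset.Ico 1 N,
      ∑ k ∈ Finset.range (N - h), c (k + h) * (starRingEnd ℂ) (c k)).re := by
    induction N with
    | zero => simp
    | succ N ih =>
      rw [sum_range_mul_conj_eq (fun a b => c a * (starRingEnd ℂ) (c b)), Finset.sum_range_succ,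
        ← Finset.mul_sum, ← map_sum, Complex.add_re, mul_add, ← Complex.normSq_eq_norm_sq,
        Complex.normSq_add, Complex.normSq_eq_norm_sq, ih, Complex.normSq_eq_norm_sq, hc]
      have : ((∑ k ∈ Finset.range N, c k) * (starRingEnd ℂ) (c N)).re =
          (c N * (starRingEnd ℂ) (∑ k ∈ Finset.range N, c k)).re := by
        simp only [Complex.mul_re, Complex.conj_re, Complex.conj_im]; ring
      rw [this]; push_cast; ring
  rw [hid]
  have h1 : (∑ h ∈ Finset.Ico 1 N,
      ∑ k ∈ Finset.range (N - h), c (k + h) * (starRingEnd ℂ) (c k)).re ≤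
      ∑ h ∈ Finset.Ico 1 N,
        ‖∑ k ∈ Finset.range (N - h), c (k + h) * (starRingEnd ℂ) (c k)‖ :=
    (Complex.re_le_norm _).trans (norm_sum_le _ _)
  have h2 : ∑ h ∈ Finset.Ico 1 N,
        ‖∑ k ∈ Finset.range (N - h), c (k + h) * (starRingEnd ℂ) (c k)‖ ≤
      ∑ h ∈ Finset.range N,
        ‖∑ k ∈ Finset.range (N - h), c (k + h) * (starRingEnd ℂ) (c k)‖ := by
    refine Finset.sum_le_sum_of_subset_of_nonneg ?_ fun _ _ _ => norm_nonneg _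
    intro h hh
    simp only [Finset.mem_Ico, Finset.mem_range] at hh ⊢
    exact hh.2
  linarith

/-- The geometric sum `∑_{k < N - h} e(h x k)` arising from differencing a quadratic phase. -/
noncomputable def weylWeight (x : ℝ) (N h : ℕ) : ℝ :=
  ‖∑ k ∈ Finset.range (N - h), Complex.exp (Complex.I * ((2 * Real.pi * (h * x) : ℝ) : ℂ)) ^ k‖

theorem weylWeight_nonneg (x : ℝ) (N h : ℕ) : 0 ≤ weylWeight x N h := norm_nonneg _

theorem norm_exp_I_mul_ofReal (y : ℝ) : ‖Complex.exp (Complex.I * (y : ℂ))‖ = 1 := by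
  rw [mul_comm]; exact Complex.norm_exp_ofReal_mul_I y

theorem weylWeight_le (x : ℝ) (N h : ℕ) : weylWeight x N h ≤ N := by
  refine (norm_sum_le _ _).trans ?_
  simp only [norm_pow, norm_exp_I_mul_ofReal, one_pow, Finset.sum_const, Finset.card_range,
    nsmul_eq_mul, mul_one]
  exact_mod_cast Nat.sub_le _ _

theorem four_mul_distInt_le (x : ℝ) (h : ℕ) :
    4 * distInt x h ≤ ‖Complex.exp (Complex.I * ((2 * Real.pi * (h * x) : ℝ) : ℂ)) - 1‖ := by
  set y : ℝ := (h : ℝ) * x - round ((h : ℝ) * x) with hy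
  have hexp : Complex.exp (Complex.I * ((2 * Real.pi * (h * x) : ℝ) : ℂ)) =
      Complex.exp (Complex.I * ((2 * Real.pi * y : ℝ) : ℂ)) := by
    rw [Complex.exp_eq_exp_iff_exists_int]
    refine ⟨round ((h : ℝ) * x), ?_⟩
    rw [hy]; push_cast; ring
  rw [hexp, Complex.norm_exp_I_mul_ofReal_sub_one, Real.norm_eq_abs, abs_mul]
  have hy2 : |y| ≤ 1 / 2 := abs_sub_round _
  have hsin := Real.mul_abs_le_abs_sin (x := 2 * Real.pi * y / 2) (by
    rw [show 2 * Real.pi * y / 2 = Real.pi * y by ring, abs_mul, abs_of_pos Real.pi_pos]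
    nlinarith [Real.pi_pos])
  have h1 : 2 / Real.pi * |2 * Real.pi * y / 2| = 2 * |y| := by
    rw [show 2 * Real.pi * y / 2 = Real.pi * y by ring, abs_mul, abs_of_pos Real.pi_pos]
    field_simp
  rw [h1] at hsin
  have : distInt x h = |y| := rfl
  rw [this, abs_of_pos (by norm_num : (0 : ℝ) < 2)]
  linarith

theorem weylWeight_mul_distInt_le (x : ℝ) (N h : ℕ) :
    weylWeight x N h * distInt x h ≤ 1 / 2 := by
  have h4 := four_mul_distInt_le x h
  unfold weylWeight
  set z := Complex.exp (Complex.I * ((2 * Real.pi * (h * x) : ℝ) : ℂ)) with hz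
  have hz1 : ‖z‖ = 1 := norm_exp_I_mul_ofReal _
  have h5 : ‖∑ k ∈ Finset.range (N - h), z ^ k‖ * ‖z - 1‖ ≤ 2 := by
    rw [← norm_mul, geom_sum_mul]
    refine (norm_sub_le _ _).trans ?_
    rw [norm_pow, hz1]; norm_num
  have := mul_le_mul_of_nonneg_left h4 (norm_nonneg (∑ k ∈ Finset.range (N - h), z ^ k))
  linarith

theorem norm_thetaSum_sq_le (x t : ℝ) (N : ℕ) :
    ‖thetaSum x t N‖ ^ 2 ≤ N + 2 * ∑ h ∈ Finset.range N, weylWeight x N h := by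
  set φ : ℕ → ℝ := fun k => Real.pi * ((k : ℝ) + 1) ^ 2 * x + 2 * Real.pi * (k + 1) * t with hφ
  set c : ℕ → ℂ := fun k => Complex.exp (Complex.I * (φ k : ℂ)) with hc
  have hS : thetaSum x t N = ∑ k ∈ Finset.range N, c k := by
    unfold thetaSum
    rw [← Finset.Ico_add_one_right_eq_Icc, Finset.sum_Ico_eq_sum_range]
    refine Finset.sum_congr (by simp) fun k _ => ?_
    simp only [hc, hφ]
    congr 1; push_cast; ring
  rw [hS]
  refine (norm_sum_range_sq_le c (fun k => norm_exp_I_mul_ofReal _) N).trans_eq ?_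
  congr 2
  refine Finset.sum_congr rfl fun h _ => ?_
  unfold weylWeight
  set θ : ℝ := Real.pi * (2 * h + h ^ 2) * x + 2 * Real.pi * h * t
  have hterm : ∀ k, c (k + h) * (starRingEnd ℂ) (c k) = Complex.exp (Complex.I * (θ : ℂ)) *
      Complex.exp (Complex.I * ((2 * Real.pi * (h * x) : ℝ) : ℂ)) ^ k := by
    intro k
    simp only [hc]
    rw [← Complex.exp_conj, ← Complex.exp_nat_mul, ← Complex.exp_add, ← Complex.exp_add]
    congr 1
    simp only [map_mul, Complex.conj_I, Complex.conj_ofReal, hφ, θ]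
    push_cast; ring
  simp_rw [hterm]
  rw [← Finset.mul_sum, norm_mul, norm_exp_I_mul_ofReal, one_mul]

/-- Dyadic decomposition of a sum of weights dominated by `1 / (2 ‖h x‖)`. -/
theorem sum_weight_le_dyadic {x : ℝ} {w : ℕ → ℝ} (hw0 : ∀ h, 0 ≤ w h)
    (hwd : ∀ h, w h * distInt x h ≤ 1 / 2) (N J : ℕ) :
    ∑ h ∈ (Finset.range N).filter (fun h => ¬ distInt x h < 1 / 2 ^ J), w h ≤
      ∑ j ∈ Finset.range J,
        2 ^ j * (((Finset.range N).filter (fun h => distInt x h < 1 / 2 ^ j)).card : ℝ) := by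
  induction J with
  | zero =>
    rw [Finset.filter_false_of_mem]
    · simp
    · intro h _
      have : distInt x h ≤ 1 / 2 := abs_sub_round _
      simp only [pow_zero, not_not]; linarith
  | succ J ih =>
    rw [Finset.sum_range_succ]
    set A := (Finset.range N).filter (fun h => ¬ distInt x h < 1 / 2 ^ J)
    set B := (Finset.range N).filter (fun h => distInt x h < 1 / 2 ^ J)
    set B' := B.filter (fun h => ¬ distInt x h < 1 / 2 ^ (J + 1))
    have hsub : (Finset.range N).filter (fun h => ¬ distInt x h < 1 / 2 ^ (J + 1)) ⊆ A ∪ B' := by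
      intro h hh
      simp only [A, B', B, Finset.mem_union, Finset.mem_filter] at hh ⊢
      tauto
    have h1 : ∑ h ∈ B', w h ≤ 2 ^ J * (B.card : ℝ) := by
      have h2 : ∀ h ∈ B', w h ≤ 2 ^ J := by
        intro h hh
        have h3 := not_lt.1 (Finset.mem_filter.1 hh).2
        have h4 : w h * (1 / 2 ^ (J + 1)) ≤ 1 / 2 :=
          (mul_le_mul_of_nonneg_left h3 (hw0 h)).trans (hwd h)
        rw [pow_succ, mul_one_div, div_le_iff₀ (by positivity)] at h4
        linarith
      refine (Finset.sum_le_card_nsmul _ _ _ h2).trans ?_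
      rw [nsmul_eq_mul, mul_comm]
      gcongr
      exact Finset.filter_subset _ _
    calc _ ≤ ∑ h ∈ A ∪ B', w h :=
          Finset.sum_le_sum_of_subset_of_nonneg hsub fun _ _ _ => hw0 _
      _ ≤ ∑ h ∈ A, w h + ∑ h ∈ B', w h := by
          rw [← Finset.sum_union_inter]
          have : 0 ≤ ∑ h ∈ A ∩ B', w h := Finset.sum_nonneg fun _ _ => hw0 _
          linarith
      _ ≤ _ := add_le_add ih h1

theorem sum_weight_le {x : ℝ} {p P : ℤ} {q Q : ℕ} (hq : 0 < q) (hpq : IsCoprime p (q : ℤ))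
    (hx : |(q : ℝ) * x - p| ≤ 1 / q) (hPQ : IsCoprime P (Q : ℤ))
    (hX : |(Q : ℝ) * x - P| ≤ 1 / Q) {w : ℕ → ℝ} {N : ℕ} (hw0 : ∀ h, 0 ≤ w h)
    (hwN : ∀ h, w h ≤ N) (hwd : ∀ h, w h * distInt x h ≤ 1 / 2) (hqN : q ≤ N) (hNQ : N ≤ Q) :
    ∑ h ∈ Finset.range N, w h ≤
      12 * N * (Nat.log 2 q + 1) + 30 * min ((N : ℝ) ^ 2 / q) (N * √(Q / q)) := by
  have hQ : 0 < Q := by omega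
  have hq0 : (0 : ℝ) < q := by exact_mod_cast hq
  have hQ0 : (0 : ℝ) < Q := by exact_mod_cast hQ
  have hN0 : (0 : ℝ) < N := by exact_mod_cast (by omega : 0 < N)
  have hqN' : (1 : ℝ) ≤ N / q := by
    rw [le_div_iff₀ hq0, one_mul]; exact_mod_cast hqN
  have hNQ' : (N : ℝ) / Q ≤ 1 := by
    rw [div_le_iff₀ hQ0, one_mul]; exact_mod_cast hNQ
  have hcount : ∀ r : ℝ, 0 ≤ r →
      (((Finset.range N).filter (fun h => distInt x h < r)).card : ℝ) ≤
        12 * N * r + 6 * (N / q) := by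
    intro r hr
    refine (card_distInt_lt hq hpq hx hr N).trans ?_
    have : (2 * N / q + 1 : ℝ) ≤ 3 * (N / q) := by
      rw [mul_div_assoc]; linarith
    calc _ ≤ (3 * (N / q : ℝ)) * (4 * q * r + 2) := by gcongr
      _ = _ := by field_simp; ring
  have hcountQ : ∀ r : ℝ, 0 ≤ r →
      (((Finset.range N).filter (fun h => distInt x h < r)).card : ℝ) ≤ 12 * Q * r + 6 := by
    intro r hr
    refine (card_distInt_lt hQ hPQ hX hr N).trans ?_
    have : (2 * N / Q + 1 : ℝ) ≤ 3 := by
      rw [mul_div_assoc]; linarith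
    calc _ ≤ (3 : ℝ) * (4 * Q * r + 2) := by gcongr
      _ = _ := by ring
  set J := Nat.log 2 q with hJ
  have hJ1 : (2 : ℝ) ^ J ≤ q := by exact_mod_cast Nat.pow_log_le_self 2 hq.ne'
  have hJ2 : (q : ℝ) ≤ 2 * 2 ^ J := by
    have := (Nat.lt_pow_succ_log_self (by norm_num : 1 < 2) q).le
    rw [pow_succ, mul_comm] at this
    exact_mod_cast this
  set E := (Finset.range N).filter (fun h => distInt x h < 1 / 2 ^ J) with hE
  have hsplit := Finset.sum_filter_add_sum_filter_not (Finset.range N)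
    (fun h => distInt x h < 1 / 2 ^ J) w
  rw [← hsplit]
  have hreg : ∑ h ∈ (Finset.range N).filter (fun h => ¬ distInt x h < 1 / 2 ^ J), w h ≤
      12 * N * J + 6 * N := by
    refine (sum_weight_le_dyadic hw0 hwd N J).trans ?_
    have h1 : ∀ j ∈ Finset.range J,
        2 ^ j * (((Finset.range N).filter (fun h => distInt x h < 1 / 2 ^ j)).card : ℝ) ≤
          12 * N + 6 * (N / q) * 2 ^ j := by
      intro j _
      calc _ ≤ (2 : ℝ) ^ j * (12 * N * (1 / 2 ^ j) + 6 * (N / q)) := by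
            gcongr; exact hcount _ (by positivity)
        _ = _ := by field_simp
    refine (Finset.sum_le_sum h1).trans ?_
    rw [Finset.sum_add_distrib, ← Finset.mul_sum (Finset.range J) (fun j => (2 : ℝ) ^ j),
      geom_sum_eq (by norm_num)]
    simp only [Finset.sum_const, Finset.card_range, nsmul_eq_mul]
    have : 6 * (N / q : ℝ) * ((2 ^ J - 1) / (2 - 1)) ≤ 6 * N := by
      calc _ ≤ 6 * (N / q : ℝ) * q := by
            gcongr; norm_num; linarith
        _ = _ := by field_simp
    linarith
  have hEcard : (E.card : ℝ) ≤ 30 * (N / q) := by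
    refine (hcount _ (by positivity)).trans ?_
    have : (1 : ℝ) / 2 ^ J ≤ 2 / q := by
      rw [div_le_div_iff₀ (by positivity) hq0]; linarith
    calc _ ≤ 12 * N * (2 / q : ℝ) + 6 * (N / q) := by gcongr
      _ = _ := by ring
  have hE1 : ∑ h ∈ E, w h ≤ 30 * ((N : ℝ) ^ 2 / q) := by
    refine (Finset.sum_le_card_nsmul _ _ _ fun h _ => hwN h).trans ?_
    rw [nsmul_eq_mul]
    calc _ ≤ 30 * (N / q : ℝ) * N := by gcongr
      _ = _ := by ring
  set ρ : ℝ := √(Q / q) with hρ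
  have hρ0 : 0 < ρ := Real.sqrt_pos.2 (by positivity)
  have hρ2 : ρ ^ 2 = Q / q := Real.sq_sqrt (by positivity)
  have hE2 : ∑ h ∈ E, w h ≤ 6 * N + 30 * (N * ρ) := by
    rw [← Finset.sum_filter_add_sum_filter_not E (fun h => distInt x h < ρ / Q)]
    have h1 : ∑ h ∈ E.filter (fun h => distInt x h < ρ / Q), w h ≤ (12 * ρ + 6) * N := by
      refine (Finset.sum_le_card_nsmul _ _ _ fun h _ => hwN h).trans ?_
      rw [nsmul_eq_mul]
      gcongr
      calc _ ≤ (((Finset.range N).filter (fun h => distInt x h < ρ / Q)).card : ℝ) := by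
            gcongr; exact Finset.filter_subset _ _
        _ ≤ 12 * Q * (ρ / Q) + 6 := hcountQ _ (by positivity)
        _ = _ := by field_simp
    have h2 : ∑ h ∈ E.filter (fun h => ¬ distInt x h < ρ / Q), w h ≤ 15 * (N * ρ) := by
      have h3 : ∀ h ∈ E.filter (fun h => ¬ distInt x h < ρ / Q), w h ≤ Q / (2 * ρ) := by
        intro h hh
        have h4 := not_lt.1 (Finset.mem_filter.1 hh).2
        have h5 : w h * (ρ / Q) ≤ 1 / 2 :=
          (mul_le_mul_of_nonneg_left h4 (hw0 h)).trans (hwd h)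
        rw [mul_div_assoc', div_le_iff₀ hQ0] at h5
        rw [le_div_iff₀ (by positivity)]
        linarith
      refine (Finset.sum_le_card_nsmul _ _ _ h3).trans ?_
      rw [nsmul_eq_mul]
      calc _ ≤ 30 * (N / q : ℝ) * (Q / (2 * ρ)) := by
            gcongr
            exact (Nat.cast_le.2 (Finset.card_le_card (Finset.filter_subset _ _))).trans hEcard
        _ = 15 * N * (Q / q) / ρ := by field_simp; ring
        _ = _ := by rw [← hρ2]; field_simp
    nlinarith [mul_pos hN0 hρ0]
  rcases min_choice ((N : ℝ) ^ 2 / q) (N * ρ) with h | h <;> rw [h] <;> linarith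

/-- The bound for the theta sum of length `N ∈ [Q_k, Q_{k+1}]`. -/
theorem norm_thetaSum_le {x : ℝ} (hx : Irrational x) (t : ℝ) (k N : ℕ)
    (hqN : convDen x k ≤ N) (hNQ : N ≤ convDen x (k + 1)) :
    ‖thetaSum x t N‖ ≤ 8 * √(N * (Nat.log 2 N + 1)) +
      8 * min (N / √(convDen x k)) (√N * √√(convDen x (k + 1) / convDen x k)) := by
  obtain ⟨p, q, hq, hpq, hxq⟩ := exists_coprime_convDen hx k
  obtain ⟨P, Q, hQ, hPQ, hxQ⟩ := exists_coprime_convDen hx (k + 1)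
  have hq1 : (1 : ℝ) ≤ q := hq ▸ one_le_convDen hx k
  rw [← hq] at hqN
  rw [← hQ] at hNQ
  rw [← hq, ← hQ]
  have hq0 : 0 < q := by exact_mod_cast hq1
  have hqN' : q ≤ N := by exact_mod_cast hqN
  have hw := sum_weight_le hq0 hpq hxq hPQ hxQ (weylWeight_nonneg x N) (weylWeight_le x N)
    (weylWeight_mul_distInt_le x N) hqN' (by exact_mod_cast hNQ)
  have hS := norm_thetaSum_sq_le x t N
  have hlog : (Nat.log 2 q : ℝ) ≤ Nat.log 2 N := by exact_mod_cast Nat.log_mono_right hqN'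
  set a : ℝ := N * (Nat.log 2 N + 1) with ha
  set b : ℝ := min ((N : ℝ) ^ 2 / q) (N * √(Q / q)) with hb
  have ha0 : 0 ≤ a := by positivity
  have hb0 : 0 ≤ b := by positivity
  have hmin : min (N / √q) (√N * √√(Q / q)) = √b := by
    rw [hb, Real.sqrt_monotone.map_min, Real.sqrt_mul (Nat.cast_nonneg _),
      Real.sqrt_div (sq_nonneg (N : ℝ)), Real.sqrt_sq (Nat.cast_nonneg _)]
  rw [hmin]
  have hNa : (N : ℝ) ≤ a := by
    rw [ha]; nlinarith [Nat.cast_nonneg (α := ℝ) N, Nat.cast_nonneg (α := ℝ) (Nat.log 2 N)]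
  have h1 : 12 * N * (Nat.log 2 q + 1 : ℝ) ≤ 12 * a := by
    rw [ha, mul_assoc]; gcongr
  refine abs_le_of_sq_le_sq' (a := ‖thetaSum x t N‖) ?_ (by positivity) |>.2
  have := Real.sq_sqrt ha0
  have := Real.sq_sqrt hb0
  nlinarith [mul_nonneg (Real.sqrt_nonneg a) (Real.sqrt_nonneg b)]

theorem rpow_neg_one_sub_le {e : ℝ} (he : 0 < e) (he1 : e ≤ 1) {n : ℕ} (hn : 1 ≤ n) :
    (n : ℝ) ^ (-1 - e) ≤ 2 / e * ((n : ℝ) ^ (-e) - ((n + 1 : ℕ) : ℝ) ^ (-e)) := by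
  have hn0 : (0 : ℝ) < n := by exact_mod_cast hn
  have hn1 : (1 : ℝ) ≤ n := by exact_mod_cast hn
  have h1 : ((n + 1 : ℕ) : ℝ) ^ (-e) = (n : ℝ) ^ (-e) * (1 + -(1 / (n + 1 : ℝ))) ^ e := by
    rw [show (1 + -(1 / (n + 1 : ℝ))) = n / (n + 1) by field_simp; ring,
      Real.div_rpow hn0.le (by positivity), Real.rpow_neg hn0.le, Real.rpow_neg (by positivity)]
    push_cast
    field_simp
  have h2 : (1 + -(1 / (n + 1 : ℝ))) ^ e ≤ 1 + e * -(1 / (n + 1 : ℝ)) := by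
    refine rpow_one_add_le_one_add_mul_self ?_ he.le he1
    rw [neg_le_neg_iff, div_le_one (by positivity)]; linarith
  have h3 : (n : ℝ) ^ (-1 - e) = (n : ℝ) ^ (-e) / n := by
    rw [show -1 - e = -e - 1 by ring, Real.rpow_sub_one hn0.ne']
  have h4 : 0 < (n : ℝ) ^ (-e) := by positivity
  rw [h1, h3]
  calc (n : ℝ) ^ (-e) / n ≤ (n : ℝ) ^ (-e) * (2 / (n + 1)) := by
        rw [div_eq_mul_inv]
        gcongr
        rw [inv_eq_one_div, div_le_div_iff₀ hn0 (by positivity)]; linarith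
    _ = 2 / e * ((n : ℝ) ^ (-e) * (1 - (1 + e * -(1 / (n + 1 : ℝ))))) := by field_simp; ring
    _ ≤ 2 / e * ((n : ℝ) ^ (-e) * (1 - (1 + -(1 / (n + 1 : ℝ))) ^ e)) := by gcongr
    _ = _ := by ring

theorem sum_Ico_rpow_neg_le {e : ℝ} (he : 0 < e) (he1 : e ≤ 1) {a : ℕ} (ha : 1 ≤ a) (b : ℕ) :
    ∑ n ∈ Finset.Ico a b, (n : ℝ) ^ (-1 - e) ≤ 2 / e * (a : ℝ) ^ (-e) := by
  rcases le_total b a with hab | hab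
  · rw [Finset.Ico_eq_empty (by omega), Finset.sum_empty]; positivity
  calc _ ≤ ∑ n ∈ Finset.Ico a b, 2 / e * ((n : ℝ) ^ (-e) - ((n + 1 : ℕ) : ℝ) ^ (-e)) :=
        Finset.sum_le_sum fun n hn =>
          rpow_neg_one_sub_le he he1 (ha.trans (Finset.mem_Ico.1 hn).1)
    _ = 2 / e * ((a : ℝ) ^ (-e) - (b : ℝ) ^ (-e)) := by
        rw [← Finset.mul_sum]
        congr 1
        have := Finset.sum_Ico_sub (fun n : ℕ => (n : ℝ) ^ (-e)) hab
        rw [← neg_sub, ← this, ← Finset.sum_neg_distrib]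
        exact Finset.sum_congr rfl fun n _ => by ring
    _ ≤ _ := by
        gcongr
        have : 0 ≤ (b : ℝ) ^ (-e) := by positivity
        linarith

theorem sum_range_rpow_le {e : ℝ} (he : 0 < e) (he1 : e ≤ 1) (b : ℕ) :
    ∑ n ∈ Finset.range b, ((n + 1 : ℕ) : ℝ) ^ (e - 1) ≤ (b : ℝ) ^ e / e := by
  induction b with
  | zero => simp [Real.zero_rpow he.ne']
  | succ b ih =>
    rw [Finset.sum_range_succ]
    set n : ℝ := ((b + 1 : ℕ) : ℝ) with hn
    have hb : (b : ℝ) = n - 1 := by rw [hn]; push_cast; ring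
    have hn1 : 1 ≤ n := by rw [hn]; push_cast; linarith [Nat.cast_nonneg (α := ℝ) b]
    have hn0 : 0 < n := by linarith
    have h1 : (b : ℝ) ^ e = n ^ e * (1 + -(1 / n)) ^ e := by
      rw [← Real.mul_rpow hn0.le, hb]
      · congr 1; field_simp; ring
      · rw [← sub_eq_add_neg, sub_nonneg, div_le_one hn0]; exact hn1
    have h2 : (1 + -(1 / n)) ^ e ≤ 1 + e * -(1 / n) := by
      refine rpow_one_add_le_one_add_mul_self ?_ he.le he1
      rw [neg_le_neg_iff, div_le_one hn0]; exact hn1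
    have h3 : n ^ (e - 1) = n ^ e / n := Real.rpow_sub_one hn0.ne' e
    have h4 : (b : ℝ) ^ e / e ≤ n ^ e * (1 + e * -(1 / n)) / e := by
      rw [h1]; gcongr
    have h5 : n ^ e * (1 + e * -(1 / n)) / e = n ^ e / e - n ^ e / n := by field_simp; ring
    rw [h3]; linarith

theorem sum_Ico_le_sum_range_succ {f : ℕ → ℝ} (hf : ∀ n, 0 ≤ f n) {a : ℕ} (ha : 1 ≤ a) (b : ℕ) :
    ∑ n ∈ Finset.Ico a b, f n ≤ ∑ n ∈ Finset.range b, f (n + 1) := by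
  rw [Finset.range_eq_Ico, Finset.sum_Ico_add' f 0 b 1]
  refine Finset.sum_le_sum_of_subset_of_nonneg (fun n hn => ?_) fun _ _ _ => hf _
  simp only [Finset.mem_Ico] at hn ⊢
  omega

/-- The natural number cut-off `⌊√(q Q)⌋`. -/
noncomputable def sqrtCut (q Q : ℕ) : ℕ := ⌊√((q : ℝ) * Q)⌋₊

theorem le_sqrtCut {q Q : ℕ} (h : q ≤ Q) : q ≤ sqrtCut q Q := by
  refine Nat.le_floor (Real.le_sqrt_of_sq_le ?_)
  rw [sq]; gcongr

theorem sqrtCut_le {q Q : ℕ} (h : q ≤ Q) : sqrtCut q Q ≤ Q := by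
  refine Nat.floor_le_of_le ((Real.sqrt_le_left (Nat.cast_nonneg _)).2 ?_)
  rw [sq]; gcongr

theorem sqrt_rpow_mul_sqrt_sqrt {s q Q : ℝ} (hq : 0 < q) (hQ : 0 < Q) :
    √(q * Q) ^ (1 / 2 - s) * √√(Q / q) = Q ^ ((1 - s) / 2) / q ^ (s / 2) := by
  have hdiv : ∀ a b : ℝ, a / q ^ b = a * q ^ (-b) := fun a b => by
    rw [Real.rpow_neg hq.le, div_eq_mul_inv]
  rw [Real.sqrt_eq_rpow, Real.sqrt_eq_rpow, Real.sqrt_eq_rpow, ← Real.rpow_mul (by positivity),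
    ← Real.rpow_mul (by positivity), Real.mul_rpow hq.le hQ.le, Real.div_rpow hQ.le hq.le,
    hdiv, hdiv]
  calc _ = (Q ^ (1 / 2 * (1 / 2 - s)) * Q ^ (1 / 2 * (1 / 2) : ℝ)) *
        (q ^ (1 / 2 * (1 / 2 - s)) * q ^ (-(1 / 2 * (1 / 2)) : ℝ)) := by ring
    _ = _ := by
      rw [← Real.rpow_add hQ, ← Real.rpow_add hq]; congr 2 <;> ring

theorem sqrt_rpow_div_sqrt {s q Q : ℝ} (hq : 0 < q) (hQ : 0 < Q) :
    √(q * Q) ^ (1 - s) / √q = Q ^ ((1 - s) / 2) / q ^ (s / 2) := by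
  have hdiv : ∀ a b : ℝ, a / q ^ b = a * q ^ (-b) := fun a b => by
    rw [Real.rpow_neg hq.le, div_eq_mul_inv]
  rw [Real.sqrt_eq_rpow, Real.sqrt_eq_rpow, ← Real.rpow_mul (by positivity),
    Real.mul_rpow hq.le hQ.le, hdiv, hdiv]
  calc _ = Q ^ (1 / 2 * (1 - s)) * (q ^ (1 / 2 * (1 - s)) * q ^ (-(1 / 2) : ℝ)) := by ring
    _ = _ := by
      rw [← Real.rpow_add hq]; congr 2 <;> ring

/-- The sum over `q ≤ N < Q` of the resonant part of the bound for `N ^ (-s - 1) |S_N|`. -/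
theorem sum_Ico_rpow_mul_min_le {s : ℝ} (hs : 1 / 2 < s) (hs1 : s ≤ 1) {q Q : ℕ} (hq : 1 ≤ q)
    (hqQ : q ≤ Q) :
    ∑ N ∈ Finset.Ico q Q, (N : ℝ) ^ (-s - 1) * min (N / √q) (√N * √√((Q : ℝ) / q)) ≤
      (∑ N ∈ Finset.Ico q (sqrtCut q Q), (N : ℝ) ^ (-s)) / √q +
        4 / (s - 1 / 2) * ((Q : ℝ) ^ ((1 - s) / 2) / (q : ℝ) ^ (s / 2)) := by
  have hq0 : (0 : ℝ) < q := by exact_mod_cast hq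
  have hQ0 : (0 : ℝ) < Q := by exact_mod_cast (hq.trans hqQ)
  have hqM := le_sqrtCut hqQ
  have hMQ := sqrtCut_le hqQ
  set M := sqrtCut q Q with hM
  have hM1 : 1 ≤ M := hq.trans hqM
  have hM0 : (0 : ℝ) < M := by exact_mod_cast hM1
  have he : 0 < s - 1 / 2 := by linarith
  rw [← Finset.sum_Ico_consecutive _ hqM hMQ]
  refine add_le_add ?_ ?_
  · rw [Finset.sum_div]
    refine Finset.sum_le_sum fun N hN => ?_
    have hN0 : (0 : ℝ) < N := by exact_mod_cast hq.trans (Finset.mem_Ico.1 hN).1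
    calc _ ≤ (N : ℝ) ^ (-s - 1) * (N / √q) := by gcongr; exact min_le_left _ _
      _ = _ := by rw [Real.rpow_sub_one hN0.ne']; field_simp
  · set e := s - 1 / 2 with hee
    have h1 : ∀ N ∈ Finset.Ico M Q, (N : ℝ) ^ (-s - 1) * min (N / √q) (√N * √√((Q : ℝ) / q)) ≤
        (N : ℝ) ^ (-1 - e) * √√((Q : ℝ) / q) := by
      intro N hN
      have hN0 : (0 : ℝ) < N := by exact_mod_cast hM1.trans (Finset.mem_Ico.1 hN).1
      calc _ ≤ (N : ℝ) ^ (-s - 1) * (√N * √√((Q : ℝ) / q)) := by gcongr; exact min_le_right _ _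
        _ = _ := by
          rw [← mul_assoc, Real.sqrt_eq_rpow (N : ℝ), ← Real.rpow_add hN0]
          congr 2; rw [hee]; ring
    refine (Finset.sum_le_sum h1).trans ?_
    rw [← Finset.sum_mul]
    set Z : ℝ := √((q : ℝ) * Q) with hZ
    have hZ0 : 0 < Z := Real.sqrt_pos.2 (by positivity)
    have hZM : Z / 2 ≤ M := by
      have h2 := Nat.lt_floor_add_one Z
      have h3 : (1 : ℝ) ≤ M := by exact_mod_cast hM1
      change Z < (M : ℝ) + 1 at h2
      linarith
    have h4 : (M : ℝ) ^ (-e) ≤ 2 * Z ^ (-e) := by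
      calc (M : ℝ) ^ (-e) ≤ (Z / 2) ^ (-e) :=
            Real.rpow_le_rpow_of_nonpos (by positivity) hZM (by linarith)
        _ = 2 ^ e * Z ^ (-e) := by
            rw [Real.div_rpow hZ0.le (by norm_num), Real.rpow_neg (by norm_num : (0 : ℝ) ≤ 2)]
            field_simp
        _ ≤ 2 ^ (1 : ℝ) * Z ^ (-e) := by
            gcongr
            · norm_num
            · linarith
        _ = _ := by rw [Real.rpow_one]
    have h5 := sqrt_rpow_mul_sqrt_sqrt (s := s) hq0 hQ0
    calc _ ≤ 2 / e * (M : ℝ) ^ (-e) * √√((Q : ℝ) / q) := by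
          gcongr; exact sum_Ico_rpow_neg_le he (by linarith) hM1 Q
      _ ≤ 2 / e * (2 * Z ^ (-e)) * √√((Q : ℝ) / q) := by gcongr
      _ = 4 / e * (Z ^ (1 / 2 - s) * √√((Q : ℝ) / q)) := by
          rw [hee, neg_sub]; ring
      _ = _ := by rw [h5]

theorem rpow_mul_min_le {s : ℝ} (hs : 1 / 2 < s) (hs1 : s ≤ 1) {q Q N : ℝ} (hq : 0 < q)
    (hQ : 0 < Q) (hN : 0 < N) :
    N ^ (-s) * min (N / √q) (√N * √√(Q / q)) ≤ Q ^ ((1 - s) / 2) / q ^ (s / 2) := by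
  have hZ0 : 0 < √(q * Q) := Real.sqrt_pos.2 (by positivity)
  rcases le_total N (√(q * Q)) with h | h
  · rw [← sqrt_rpow_div_sqrt hq hQ]
    calc _ ≤ N ^ (-s) * (N / √q) := by gcongr; exact min_le_left _ _
      _ = N ^ (1 - s) / √q := by
        rw [show 1 - s = -s + 1 by ring, Real.rpow_add_one hN.ne']; ring
      _ ≤ _ := by gcongr
  · rw [← sqrt_rpow_mul_sqrt_sqrt hq hQ]
    calc _ ≤ N ^ (-s) * (√N * √√(Q / q)) := by gcongr; exact min_le_right _ _
      _ = N ^ (1 / 2 - s) * √√(Q / q) := by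
        rw [← mul_assoc, Real.sqrt_eq_rpow N, ← Real.rpow_add hN]
        congr 2; ring
      _ ≤ _ := by
        refine mul_le_mul_of_nonneg_right ?_ (by positivity)
        exact Real.rpow_le_rpow_of_nonpos hZ0 h (by linarith)

/-- A nonnegative sequence is summable if its sums over the blocks of a partition of a final
segment of `ℕ` are bounded by a summable sequence. -/
theorem summable_of_sum_Ico_le {f c : ℕ → ℝ} (hf : ∀ n, 0 ≤ f n) {u : ℕ → ℕ} (hu : Monotone u)
    (hut : Tendsto u atTop atTop) (hc : Summable c)
    (h : ∀ k, ∑ n ∈ Finset.Ico (u k) (u (k + 1)), f n ≤ c k) : Summable f := by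
  have hc0 : ∀ k, 0 ≤ c k := fun k => (Finset.sum_nonneg fun n _ => hf n).trans (h k)
  have hblocks : ∀ k, ∑ n ∈ Finset.range (u k), f n ≤
      ∑ n ∈ Finset.range (u 0), f n + ∑ j ∈ Finset.range k, c j := by
    intro k
    induction k with
    | zero => simp
    | succ k ih =>
      rw [Finset.range_eq_Ico, ← Finset.sum_Ico_consecutive _ (Nat.zero_le _) (hu k.le_succ),
        ← Finset.range_eq_Ico, Finset.sum_range_succ]
      linarith [h k]
  refine summable_of_sum_range_le (c := ∑ n ∈ Finset.range (u 0), f n + ∑' j, c j) hf fun n => ?_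
  obtain ⟨k, hk⟩ := (hut.eventually_ge_atTop n).exists
  calc _ ≤ ∑ i ∈ Finset.range (u k), f i :=
        Finset.sum_le_sum_of_subset_of_nonneg (Finset.range_subset_range.2 hk) fun _ _ _ => hf _
    _ ≤ _ := hblocks k
    _ ≤ _ := by gcongr; exact hc.sum_le_tsum _ fun _ _ => hc0 _

/-- The logarithmic factor in the generic part of the bound is absorbed by a small power. -/
theorem exists_rpow_mul_sqrt_log_le {s : ℝ} (hs : 1 / 2 < s) :
    ∃ C : ℝ, ∀ N : ℕ, 1 ≤ N → (N : ℝ) ^ (-s) * √(N * (Nat.log 2 N + 1)) ≤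
      C * (N : ℝ) ^ (-((s - 1 / 2) / 2)) := by
  set e := s - 1 / 2 with he
  have he0 : 0 < e := by linarith
  have hlog2 : 0 < Real.log 2 := Real.log_pos (by norm_num)
  refine ⟨√(1 / (e * Real.log 2) + 1), fun N hN => ?_⟩
  have hN0 : (0 : ℝ) < N := by exact_mod_cast hN
  have hN1 : (1 : ℝ) ≤ N := by exact_mod_cast hN
  have h1 : (Nat.log 2 N : ℝ) ≤ (N : ℝ) ^ e / e / Real.log 2 := by
    refine (Real.natLog_le_logb N 2).trans ?_
    rw [Real.logb, Nat.cast_ofNat]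
    gcongr
    exact Real.log_le_rpow_div hN0.le he0
  have h2 : (1 : ℝ) ≤ (N : ℝ) ^ e := Real.one_le_rpow hN1 he0.le
  have h3 : (N : ℝ) * (Nat.log 2 N + 1) ≤ (1 / (e * Real.log 2) + 1) * (N : ℝ) ^ (1 + e) := by
    rw [Real.rpow_add hN0, Real.rpow_one]
    calc _ ≤ (N : ℝ) * ((N : ℝ) ^ e / e / Real.log 2 + (N : ℝ) ^ e) := by gcongr
      _ = _ := by field_simp
  calc _ ≤ (N : ℝ) ^ (-s) * √((1 / (e * Real.log 2) + 1) * (N : ℝ) ^ (1 + e)) := by gcongr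
    _ = √(1 / (e * Real.log 2) + 1) * ((N : ℝ) ^ (-s) * (N : ℝ) ^ ((1 + e) * (1 / 2))) := by
      rw [Real.sqrt_mul (by positivity), Real.sqrt_eq_rpow ((N : ℝ) ^ (1 + e)),
        ← Real.rpow_mul hN0.le]
      ring
    _ = _ := by
      rw [← Real.rpow_add hN0]; congr 2; rw [he]; ring

theorem one_div_rpow_sub_le {s : ℝ} (hs : 0 < s) (hs1 : s ≤ 1) {n : ℝ} (hn : 0 < n) :
    0 ≤ 1 / n ^ s - 1 / (n + 1) ^ s ∧ 1 / n ^ s - 1 / (n + 1) ^ s ≤ n ^ (-s - 1) := by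
  constructor
  · rw [sub_nonneg]
    gcongr
    linarith
  · have h1 : n / (n + 1) ≤ (n / (n + 1)) ^ s := by
      have h2 : n / (n + 1) ≤ 1 := by rw [div_le_one (by positivity)]; linarith
      simpa using Real.rpow_le_rpow_of_exponent_ge (by positivity) h2 hs1
    rw [Real.div_rpow hn.le (by positivity)] at h1
    have h3 : 1 / (n + 1) ^ s = n ^ (-s) * (n ^ s / (n + 1) ^ s) := by
      rw [Real.rpow_neg hn.le]; field_simp
    have h4 : (0 : ℝ) < n ^ (-s) := by positivity
    rw [one_div, ← Real.rpow_neg hn.le, h3, Real.rpow_sub_one hn.ne']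
    calc _ ≤ n ^ (-s) - n ^ (-s) * (n / (n + 1)) := by gcongr
      _ = n ^ (-s) / (n + 1) := by field_simp; ring
      _ ≤ _ := by gcongr; linarith

theorem thetaSum_succ (x t : ℝ) (n : ℕ) : thetaSum x t (n + 1) = thetaSum x t n +
    Complex.exp (Complex.I * Real.pi * ((n + 1 : ℕ) : ℂ) ^ 2 * x +
      2 * Complex.I * Real.pi * ((n + 1 : ℕ) : ℂ) * t) := by
  unfold thetaSum
  rw [Finset.sum_Icc_succ_top (by omega)]

/-- Abel summation. -/
theorem partialF_eq (s x t : ℝ) (n : ℕ) : partialF s x t n =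
    ∑ k ∈ Finset.range n, abelTerm s x t (k + 1) +
      ((1 / ((n : ℝ) + 1) ^ s : ℝ) : ℂ) * thetaSum x t n := by
  induction n with
  | zero => simp [partialF, thetaSum]
  | succ n ih =>
    have h1 : partialF s x t (n + 1) = partialF s x t n +
        (thetaSum x t (n + 1) - thetaSum x t n) / ((((n + 1 : ℕ) : ℝ) ^ s : ℝ) : ℂ) := by
      rw [thetaSum_succ]
      unfold partialF
      rw [Finset.sum_Icc_succ_top (by omega), add_sub_cancel_left]
    rw [h1, ih, Finset.sum_range_succ, abelTerm]
    push_cast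
    ring

/-- The sufficient condition common to both parts of the theorem: summability of
`Q_{k+1}^{(1-s)/2} / Q_k^{s/2}` together with a summable bound for the initial parts of the
blocks `[Q_k, Q_{k+1})`. -/
theorem abelAbsolutelyConvergent_of_summable {s x : ℝ} (hx : Irrational x) (t : ℝ)
    (hs : 1 / 2 < s) (hs1 : s ≤ 1) {u : ℕ → ℕ} (hu : ∀ k, (u k : ℝ) = convDen x k)
    (hT : Summable fun k => (u (k + 1) : ℝ) ^ ((1 - s) / 2) / (u k : ℝ) ^ (s / 2)) {c : ℕ → ℝ}
    (hc : Summable c)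
    (hcu : ∀ k, (∑ N ∈ Finset.Ico (u k) (sqrtCut (u k) (u (k + 1))), (N : ℝ) ^ (-s)) / √(u k) ≤
      c k) :
    AbelAbsolutelyConvergent s x t := by
  have he : 0 < s - 1 / 2 := by linarith
  have hs0 : 0 < s := by linarith
  have hu1 : ∀ k, 1 ≤ u k := fun k => by
    have := one_le_convDen hx k
    rw [← hu] at this
    exact_mod_cast this
  have hmono : Monotone u := fun a b hab => by
    have := convDen_mono x hab
    rw [← hu, ← hu] at this
    exact_mod_cast this
  have hut : Tendsto u atTop atTop := by
    rw [tendsto_atTop]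
    intro b
    filter_upwards [eventually_ge_atTop (b + 5)] with k hk
    have h1 := fib_le_convDen hx k
    rw [← hu] at h1
    have h2 : Nat.fib (k + 1) ≤ u k := by exact_mod_cast h1
    have := Nat.le_fib_self (show 5 ≤ k + 1 by omega)
    omega
  have hS : ∀ k N : ℕ, u k ≤ N → N ≤ u (k + 1) → ‖thetaSum x t N‖ ≤
      8 * √(N * (Nat.log 2 N + 1)) + 8 * min (N / √(u k)) (√N * √√((u (k + 1) : ℝ) / u k)) := by
    intro k N h1 h2
    have := norm_thetaSum_le hx t k N (by rw [← hu]; exact_mod_cast h1)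
      (by rw [← hu]; exact_mod_cast h2)
    rwa [← hu, ← hu] at this
  obtain ⟨C, hC⟩ := exists_rpow_mul_sqrt_log_le hs
  -- the summed absolute values
  set f : ℕ → ℝ := fun N => (N : ℝ) ^ (-s - 1) * ‖thetaSum x t N‖ with hf
  set f₁ : ℕ → ℝ := fun N => (N : ℝ) ^ (-s - 1) * (8 * √(N * (Nat.log 2 N + 1))) with hf₁
  have hf₁s : Summable f₁ := by
    have h1 : Summable fun N : ℕ => 8 * C * (N : ℝ) ^ (-1 - (s - 1 / 2) / 2) :=
      (Real.summable_nat_rpow.2 (by linarith)).mul_left _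
    refine Summable.of_nonneg_of_le (fun N => by positivity) (fun N => ?_) h1
    rcases Nat.eq_zero_or_pos N with rfl | hN
    · simp only [hf₁, Nat.cast_zero, zero_mul, Real.sqrt_zero, mul_zero]
      rw [Real.zero_rpow (by linarith), mul_zero]
    · have hN0 : (0 : ℝ) < N := by exact_mod_cast hN
      have h2 := hC N hN
      have h3 : (N : ℝ) ^ (-1 - (s - 1 / 2) / 2) = (N : ℝ) ^ (-((s - 1 / 2) / 2)) / N := by
        rw [show -1 - (s - 1 / 2) / 2 = -((s - 1 / 2) / 2) - 1 by ring,
          Real.rpow_sub_one hN0.ne']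
      simp only [hf₁]
      rw [Real.rpow_sub_one hN0.ne', h3]
      calc _ = 8 * ((N : ℝ) ^ (-s) * √(N * (Nat.log 2 N + 1))) / N := by ring
        _ ≤ 8 * (C * (N : ℝ) ^ (-((s - 1 / 2) / 2))) / N := by gcongr
        _ = _ := by ring
  have hf₂s : Summable fun N => max 0 (f N - f₁ N) := by
    refine summable_of_sum_Ico_le (fun N => le_max_left _ _) hmono hut
      ((hc.add (hT.mul_left (4 / (s - 1 / 2)))).mul_left 8) fun k => ?_
    have h1 : ∀ N ∈ Finset.Ico (u k) (u (k + 1)), max 0 (f N - f₁ N) ≤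
        8 * ((N : ℝ) ^ (-s - 1) *
          min (N / √(u k)) (√N * √√((u (k + 1) : ℝ) / u k))) := by
      intro N hN
      rw [Finset.mem_Ico] at hN
      refine max_le (by positivity) ?_
      have h2 := hS k N hN.1 hN.2.le
      have h3 : f N ≤ (N : ℝ) ^ (-s - 1) * (8 * √(N * (Nat.log 2 N + 1)) +
          8 * min (N / √(u k)) (√N * √√((u (k + 1) : ℝ) / u k))) := by
        simp only [hf]; gcongr
      simp only [hf₁] at h3 ⊢
      linarith
    refine (Finset.sum_le_sum h1).trans ?_
    rw [← Finset.mul_sum]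
    have h4 := sum_Ico_rpow_mul_min_le hs hs1 (hu1 k) (hmono k.le_succ)
    have h5 := hcu k
    gcongr
    linarith
  have hfs : Summable f := by
    refine Summable.of_nonneg_of_le (fun N => by positivity) (fun N => ?_) (hf₁s.add hf₂s)
    linarith [le_max_right 0 (f N - f₁ N)]
  have hsum : Summable fun k : ℕ => ‖abelTerm s x t (k + 1)‖ := by
    refine Summable.of_nonneg_of_le (fun _ => norm_nonneg _) (fun k => ?_)
      ((summable_nat_add_iff 1).2 hfs)
    have hk : (0 : ℝ) < ((k + 1 : ℕ) : ℝ) := by positivity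
    obtain ⟨h1, h2⟩ := one_div_rpow_sub_le hs0 hs1 hk
    rw [abelTerm, norm_mul, Complex.norm_real, Real.norm_of_nonneg h1]
    exact mul_le_mul_of_nonneg_right h2 (norm_nonneg _)
  -- the boundary term
  have hbd : Tendsto (fun N : ℕ => 1 / (N : ℝ) ^ s * ‖thetaSum x t N‖) atTop (𝓝 0) := by
    have hpow : Tendsto (fun N : ℕ => 8 * (C * (N : ℝ) ^ (-((s - 1 / 2) / 2)))) atTop (𝓝 0) := by
      have := (tendsto_rpow_neg_atTop (half_pos he)).comp tendsto_natCast_atTop_atTop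
      simpa using (this.const_mul C).const_mul 8
    have hT0 := hT.tendsto_atTop_zero
    rw [Metric.tendsto_atTop]
    intro ε hε
    obtain ⟨N₀, hN₀⟩ := eventually_atTop.1 (hpow.eventually_lt_const (half_pos hε))
    obtain ⟨K, hK⟩ := eventually_atTop.1 (hT0.eventually_lt_const (by positivity : 0 < ε / 16))
    refine ⟨max N₀ (u K), fun N hN => ?_⟩
    have hNK : u K ≤ N := (le_max_right _ _).trans hN
    have hN1 : 1 ≤ N := (hu1 K).trans hNK
    have hN0 : (0 : ℝ) < N := by exact_mod_cast hN1
    obtain ⟨k, hk1, hk2, hk3⟩ : ∃ k, K ≤ k ∧ u k ≤ N ∧ N < u (k + 1) := by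
      have hex : ∃ j, N < u j := (hut.eventually_gt_atTop N).exists
      have h1 := Nat.find_spec hex
      have h2 : K < Nat.find hex := by
        by_contra h
        exact absurd (hmono (not_lt.1 h)) (by omega)
      refine ⟨Nat.find hex - 1, by omega, ?_, ?_⟩
      · exact not_lt.1 (Nat.find_min hex (by omega))
      · rwa [Nat.sub_add_cancel (by omega)]
    have hq0 : (0 : ℝ) < u k := by exact_mod_cast hu1 k
    have hQ0 : (0 : ℝ) < u (k + 1) := by exact_mod_cast hu1 (k + 1)
    have h1 := hS k N hk2 hk3.le
    have h2 := rpow_mul_min_le hs hs1 hq0 hQ0 hN0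
    have h3 := hC N hN1
    have h4 := hN₀ N ((le_max_left _ _).trans hN)
    have h5 := hK k hk1
    rw [Real.dist_eq, sub_zero, abs_of_nonneg (by positivity), one_div, ← Real.rpow_neg hN0.le]
    calc _ ≤ (N : ℝ) ^ (-s) * (8 * √(N * (Nat.log 2 N + 1)) +
          8 * min (N / √(u k)) (√N * √√((u (k + 1) : ℝ) / u k))) := by gcongr
      _ = 8 * ((N : ℝ) ^ (-s) * √(N * (Nat.log 2 N + 1))) +
          8 * ((N : ℝ) ^ (-s) * min (N / √(u k)) (√N * √√((u (k + 1) : ℝ) / u k))) := by ring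
      _ < ε := by linarith
  refine ⟨hsum, ?_, ?_⟩
  · rw [tendsto_zero_iff_norm_tendsto_zero]
    refine hbd.congr fun N => ?_
    rw [abelBoundary, norm_mul, Complex.norm_real, Real.norm_of_nonneg (by positivity)]
  · have h1 := hsum.of_norm.hasSum.tendsto_sum_nat
    have h2 : Tendsto (fun n : ℕ => ((1 / ((n : ℝ) + 1) ^ s : ℝ) : ℂ) * thetaSum x t n)
        atTop (𝓝 0) := by
      rw [tendsto_zero_iff_norm_tendsto_zero]
      refine squeeze_zero' (Eventually.of_forall fun _ => norm_nonneg _) ?_ hbd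
      filter_upwards [eventually_ge_atTop 1] with n hn
      have hn0 : (0 : ℝ) < n := by exact_mod_cast hn
      rw [norm_mul, Complex.norm_real, Real.norm_of_nonneg (by positivity)]
      gcongr
      linarith
    have h3 := h1.add h2
    rw [add_zero] at h3
    exact h3.congr fun n => (partialF_eq s x t n).symm

theorem exists_nat_convDen {x : ℝ} (hx : Irrational x) :
    ∃ u : ℕ → ℕ, ∀ k, (u k : ℝ) = convDen x k := by
  choose p u hu _ using exists_coprime_convDen hx
  exact ⟨u, hu⟩

theorem sum_Ico_rpow_neg_le_of_lt_one {s : ℝ} (hs0 : 0 ≤ s) (hs1 : s < 1) {q Q : ℕ} (hq : 1 ≤ q)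
    (hqQ : q ≤ Q) :
    (∑ N ∈ Finset.Ico q (sqrtCut q Q), (N : ℝ) ^ (-s)) / √q ≤
      1 / (1 - s) * ((Q : ℝ) ^ ((1 - s) / 2) / (q : ℝ) ^ (s / 2)) := by
  have hq0 : (0 : ℝ) < q := by exact_mod_cast hq
  have hQ0 : (0 : ℝ) < Q := by exact_mod_cast (hq.trans hqQ)
  have he : 0 < 1 - s := by linarith
  have h1 : ∑ N ∈ Finset.Ico q (sqrtCut q Q), (N : ℝ) ^ (-s) ≤
      √((q : ℝ) * Q) ^ (1 - s) / (1 - s) := by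
    refine (sum_Ico_le_sum_range_succ (f := fun N : ℕ => (N : ℝ) ^ (-s))
      (fun _ => by positivity) hq _).trans ?_
    have h2 := sum_range_rpow_le he (by linarith) (sqrtCut q Q)
    rw [show 1 - s - 1 = -s by ring] at h2
    refine h2.trans ?_
    gcongr
    exact Nat.floor_le (Real.sqrt_nonneg _)
  rw [← sqrt_rpow_div_sqrt hq0 hQ0]
  calc _ ≤ √((q : ℝ) * Q) ^ (1 - s) / (1 - s) / √q := by gcongr
    _ = _ := by ring

theorem sum_Ico_inv_le_log {q Q : ℕ} (hq : 1 ≤ q) (hqQ : q ≤ Q) :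
    ∑ N ∈ Finset.Ico q (sqrtCut q Q), (N : ℝ) ^ (-(1 : ℝ)) ≤ 1 + Real.log Q := by
  refine (sum_Ico_le_sum_range_succ (f := fun N : ℕ => (N : ℝ) ^ (-(1 : ℝ)))
    (fun _ => by positivity) hq _).trans ?_
  have h1 := harmonic_le_one_add_log (sqrtCut q Q)
  rw [harmonic] at h1
  push_cast at h1
  simp only [Real.rpow_neg_one]
  push_cast
  refine h1.trans ?_
  have : 0 < sqrtCut q Q := hq.trans (le_sqrtCut hqQ)
  gcongr
  exact sqrtCut_le hqQ

theorem theorem4 (x : ℝ) (hx : Irrational x) (hx01 : x ∈ Set.Ioo (0 : ℝ) 1) (t : ℝ) :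
    (∀ s : ℝ, s ∈ Set.Ioo (1 / 2 : ℝ) 1 →
      Summable (fun k : ℕ => convDen x (k + 1) ^ ((1 - s) / 2) / convDen x k ^ (s / 2)) →
      AbelAbsolutelyConvergent s x t) ∧
    (Summable (fun k : ℕ => Real.log (convDen x (k + 1)) / Real.sqrt (convDen x k)) →
      AbelAbsolutelyConvergent 1 x t) := by
  obtain ⟨u, hu⟩ := exists_nat_convDen hx
  have hu1 : ∀ k, 1 ≤ u k := fun k => by
    have := one_le_convDen hx k
    rw [← hu] at this
    exact_mod_cast this
  have hmono : ∀ k, u k ≤ u (k + 1) := fun k => by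
    have := convDen_mono x k.le_succ
    rw [← hu, ← hu] at this
    exact_mod_cast this
  simp_rw [← hu]
  refine ⟨fun s hs hsum => ?_, fun hsum => ?_⟩
  · exact abelAbsolutelyConvergent_of_summable hx t hs.1 hs.2.le hu hsum
      (hsum.mul_left (1 / (1 - s)))
      fun k => sum_Ico_rpow_neg_le_of_lt_one (by linarith [hs.1]) hs.2 (hu1 k) (hmono k)
  · have hinv : Summable fun k => 1 / √(u k : ℝ) := by
      rw [← summable_nat_add_iff 1]
      refine Summable.of_nonneg_of_le (fun _ => by positivity) (fun k => ?_)
        (((summable_nat_add_iff 1).2 hsum).mul_left (1 / Real.log 2))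
      have h2 : (2 : ℝ) ≤ u (k + 1 + 1) := by
        have h3 := fib_le_convDen hx (k + 1 + 1)
        have h4 : 2 ≤ Nat.fib (k + 1 + 1 + 1) :=
          Nat.fib_mono (show 3 ≤ k + 1 + 1 + 1 by omega)
        rw [hu]
        exact le_trans (by exact_mod_cast h4) h3
      have hlog : Real.log 2 ≤ Real.log (u (k + 1 + 1)) := Real.log_le_log (by norm_num) h2
      have hlog2 : 0 < Real.log 2 := Real.log_pos (by norm_num)
      calc 1 / √(u (k + 1) : ℝ) = 1 / Real.log 2 * (Real.log 2 / √(u (k + 1) : ℝ)) := by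
            field_simp
        _ ≤ _ := by gcongr
    refine abelAbsolutelyConvergent_of_summable hx t (by norm_num) le_rfl hu ?_
      (hinv.add hsum) fun k => ?_
    · refine hinv.congr fun k => ?_
      rw [Real.sqrt_eq_rpow]; simp
    · rw [← add_div]
      gcongr
      exact sum_Ico_inv_le_log (hu1 k) (hmono k)
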